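/- Let $n\ge 2$, let $V_{n+1}$ be a real vector space of dimension $n+1$, let $\mathbb{P}_n$ be the projective space of $V_{n+1}$, and fix a point $A\in\mathbb{P}_n$. A projective frame is an ordered system $\mathcal{R}=\{A_0,A_1,\dots,A_n,E\}$ of $n+2$ points of $\mathbb{P}_n$ any $n+1$ of which are in general position; it is called adapted if $A_0=A$. Let $G$ be the stabilizer of $A$ in the group of projective transformations of $\mathbb{P}_n$ (the maps of $\mathbb{P}_n$ induced by invertible linear operators of $V_{n+1}$), and let $H$ be the kernel of the homomorphism $G\to GL(T_A\mathbb{P}_n)$, $g\mapsto d_A g$. The group $H$ acts on adapted frames pointwise. Two adapted frames $\mathcal{R}=\{A_0,\dots,A_n,E\}$ and $\mathcal{R}'=\{A'_0,\dots,A'_n,E'\}$ are in strict perspective if $A'_i$ lies on the line $A_iA_0$ and $A'_i\neq A_i$ for $i=1,\dots,n$, and $E'$ lies on the line $EA_0$ and $E'\neq E$. In this case their Desargues hyperplane $\mathcal{L}_{(\mathcal{R},\mathcal{R}')}$ is the smallest projective subspace of $\mathbb{P}_n$ that contains all the points $$B_{ij}=A_iA_j\cap A'_iA'_j\quad(1\le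 i<j\le n),\qquad B_i=A_iE\cap A'_iE'\quad(1\le i\le n).$$ **Theorem.** Let $\mathcal{R}$ and $\mathcal{R}'$ be adapted projective frames of $\mathbb{P}_n$ in strict perspective. Then $\mathcal{R}$ and $\mathcal{R}'$ lie in the same $H$-orbit if and only if $A\in\mathcal{L}_{(\mathcal{R},\mathcal{R}')}$. -/

import Mathlib

open scoped LinearAlgebra.Projectivization Topology

noncomputable section

/-! ### Projective frames -/

/-- A projective frame of an `n`-dimensional projective space: an ordered system of `n + 2` points
any `n + 1` of which are in general position.  The points are listed as `A₀, A₁, …, Aₙ, E`. -/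
structure ProjectiveFrame (V : Type*) [AddCommGroup V] [Module ℝ V] (n : ℕ) where
  points : Fin (n + 2) → ℙ ℝ V
  generic : ∀ k : Fin (n + 2), Projectivization.Independent fun i => points (k.succAbove i)

namespace ProjectiveFrame

variable {V : Type*} [AddCommGroup V] [Module ℝ V] {n : ℕ}

/-- The vertices `A₀, …, Aₙ`. -/
def vertex (R : ProjectiveFrame V n) (i : Fin (n + 1)) : ℙ ℝ V := R.points i.castSucc

/-- The unit point `E`. -/
def unit (R : ProjectiveFrame V n) : ℙ ℝ V := R.points (Fin.last (n + 1))

/-- The frame is adapted to the centre `A`: its first vertex is `A`. -/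
def IsAdapted (R : ProjectiveFrame V n) (A : ℙ ℝ V) : Prop := R.vertex 0 = A

end ProjectiveFrame

/-- The line through two (distinct) points. -/
def projLine {V : Type*} [AddCommGroup V] [Module ℝ V] (P Q : ℙ ℝ V) :
    Projectivization.Subspace ℝ V :=
  Projectivization.Subspace.span {P, Q}

namespace ProjectiveFrame

variable {V : Type*} [AddCommGroup V] [Module ℝ V] {n : ℕ}

/-- `A'ᵢ` lies on the line `AᵢA₀` for `1 ≤ i ≤ n`, and `E'` lies on the line `EA₀`. -/
def InPerspective (R R' : ProjectiveFrame V n) : Prop :=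
  (∀ i : Fin n, R'.vertex i.succ ∈ projLine (R.vertex i.succ) (R.vertex 0)) ∧
    R'.unit ∈ projLine R.unit (R.vertex 0)

/-- The frames are in perspective and corresponding points (other than the centre) differ. -/
def InStrictPerspective (R R' : ProjectiveFrame V n) : Prop :=
  InPerspective R R' ∧ (∀ i : Fin n, R'.vertex i.succ ≠ R.vertex i.succ) ∧ R'.unit ≠ R.unit

/-- The set of the points `Bᵢⱼ = AᵢAⱼ ∩ A'ᵢA'ⱼ` for `1 ≤ i < j ≤ n` and
`Bᵢ = AᵢE ∩ A'ᵢE'` for `1 ≤ i ≤ n`. -/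
def desarguesPoints (R R' : ProjectiveFrame V n) : Set (ℙ ℝ V) :=
  {B | ∃ i j : Fin n, i < j ∧
      B ∈ projLine (R.vertex i.succ) (R.vertex j.succ) ∧
      B ∈ projLine (R'.vertex i.succ) (R'.vertex j.succ)} ∪
    {B | ∃ i : Fin n,
      B ∈ projLine (R.vertex i.succ) R.unit ∧ B ∈ projLine (R'.vertex i.succ) R'.unit}

/-- The smallest projective subspace containing all the points `Bᵢⱼ` and `Bᵢ`. -/
def desarguesHyperplane (R R' : ProjectiveFrame V n) : Projectivization.Subspace ℝ V :=
  Projectivization.Subspace.span (desarguesPoints R R')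

end ProjectiveFrame

/-! ### The projective group and the stabilizer of the centre -/

/-- The group of projective transformations: the maps of the projective space induced by
the invertible linear operators. -/
def projectiveGroup (V : Type*) [AddCommGroup V] [Module ℝ V] :
    Subgroup (Equiv.Perm (ℙ ℝ V)) :=
  (MulAction.toPermHom (V ≃ₗ[ℝ] V) (ℙ ℝ V)).range

/-- The stabilizer `G` of the point `A` in the projective group. -/
abbrev centreStabilizer {V : Type*} [AddCommGroup V] [Module ℝ V] (A : ℙ ℝ V) :
    Subgroup (projectiveGroup V) :=
  MulAction.stabilizer (projectiveGroup V) A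

/-! ### Affine charts around the centre -/

/-- A basis `b₀, …, bₙ` whose first vector spans `A`, i.e. a basis that generates an adapted
frame. -/
abbrev AdaptedBasis {V : Type*} [AddCommGroup V] [Module ℝ V] (n : ℕ) (A : ℙ ℝ V) :=
  {b : Module.Basis (Fin (n + 1)) ℝ V // Projectivization.mk ℝ (b 0) (b.ne_zero 0) = A}

section Charts

variable {V : Type*} [AddCommGroup V] [Module ℝ V] {n : ℕ}

/-- The affine chart of a basis (equivalently, of the frame that it generates):
`M ↦ (x¹/x⁰, …, xⁿ/x⁰)`, where `x⁰, …, xⁿ` are homogeneous coordinates of `M`.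
It is meant on the domain `x⁰ ≠ 0`. -/
def affineChart (b : Module.Basis (Fin (n + 1)) ℝ V) (M : ℙ ℝ V) : Fin n → ℝ :=
  fun i => b.repr M.rep i.succ / b.repr M.rep 0

/-- The vector with coordinates `(1, y¹, …, yⁿ)`. -/
def affineVec (b : Module.Basis (Fin (n + 1)) ℝ V) (y : Fin n → ℝ) : V :=
  b 0 + ∑ i : Fin n, y i • b i.succ

lemma repr_affineVec_zero (b : Module.Basis (Fin (n + 1)) ℝ V) (y : Fin n → ℝ) :
    b.repr (affineVec b y) 0 = 1 := by
  simp [affineVec]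

lemma repr_affineVec_succ (b : Module.Basis (Fin (n + 1)) ℝ V) (y : Fin n → ℝ) (i : Fin n) :
    b.repr (affineVec b y) i.succ = y i := by
  simp [affineVec, Finsupp.single_apply]

lemma affineVec_ne_zero (b : Module.Basis (Fin (n + 1)) ℝ V) (y : Fin n → ℝ) :
    affineVec b y ≠ 0 := by
  intro h
  have := repr_affineVec_zero b y
  simp [h] at this

/-- The inverse of the affine chart: the point with homogeneous coordinates
`(1 : y¹ : … : yⁿ)`. -/
def affineChartInv (b : Module.Basis (Fin (n + 1)) ℝ V) (y : Fin n → ℝ) : ℙ ℝ V :=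
  Projectivization.mk ℝ (affineVec b y) (affineVec_ne_zero b y)

/-- The coordinate expression of a map of the projective space in two affine charts. -/
def coordExpr (g : ℙ ℝ V → ℙ ℝ V) (b b' : Module.Basis (Fin (n + 1)) ℝ V) :
    (Fin n → ℝ) → (Fin n → ℝ) :=
  fun y => affineChart b' (g (affineChartInv b y))

/-- The derivative at the point `A` of a map in two affine charts (the Jacobian matrix). -/
def jacobian (A : ℙ ℝ V) (g : ℙ ℝ V → ℙ ℝ V) (b b' : AdaptedBasis n A) :
    (Fin n → ℝ) →L[ℝ] (Fin n → ℝ) :=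
  fderiv ℝ (coordExpr g b.1 b'.1) (affineChart b.1 A)

lemma affineChart_mk (b : Module.Basis (Fin (n + 1)) ℝ V) (w : V) (hw : w ≠ 0) :
    affineChart b (Projectivization.mk ℝ w hw) =
      fun i : Fin n => b.repr w i.succ / b.repr w 0 := by
  obtain ⟨a, ha⟩ := Projectivization.exists_smul_eq_mk_rep ℝ w hw
  funext i
  have h0 : (a : ℝ) ≠ 0 := a.ne_zero
  simp only [affineChart, ← ha, Units.smul_def, map_smul, Finsupp.smul_apply, smul_eq_mul]
  exact mul_div_mul_left _ _ h0

lemma affineChart_centre {A : ℙ ℝ V} (b : AdaptedBasis n A) : affineChart b.1 A = 0 := by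
  obtain ⟨b, rfl⟩ := b
  rw [affineChart_mk]
  funext i
  simp

lemma affineChartInv_zero {A : ℙ ℝ V} (b : AdaptedBasis n A) : affineChartInv b.1 0 = A := by
  obtain ⟨b, rfl⟩ := b
  simp [affineChartInv, affineVec]

lemma affineChartInv_affineChart_mk (b : Module.Basis (Fin (n + 1)) ℝ V) (w : V) (hw : w ≠ 0)
    (h : b.repr w 0 ≠ 0) :
    affineChartInv b (affineChart b (Projectivization.mk ℝ w hw)) =
      Projectivization.mk ℝ w hw := by
  rw [affineChart_mk, affineChartInv, Projectivization.mk_eq_mk_iff']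
  refine ⟨(b.repr w 0)⁻¹, ?_⟩
  refine b.repr.injective (Finsupp.ext fun j => ?_)
  refine Fin.cases ?_ (fun i => ?_) j
  · rw [repr_affineVec_zero]; simp [h]
  · rw [repr_affineVec_succ]; simp [div_eq_inv_mul]

lemma affineChart_affineChartInv (b : Module.Basis (Fin (n + 1)) ℝ V) (y : Fin n → ℝ) :
    affineChart b (affineChartInv b y) = y := by
  rw [affineChartInv, affineChart_mk]
  funext i
  rw [repr_affineVec_zero, repr_affineVec_succ, div_one]

lemma coordExpr_id (b : Module.Basis (Fin (n + 1)) ℝ V) :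
    coordExpr (id : ℙ ℝ V → ℙ ℝ V) b b = id :=
  funext fun y => affineChart_affineChartInv b y

lemma jacobian_id {A : ℙ ℝ V} (b : AdaptedBasis n A) :
    jacobian A id b b = ContinuousLinearMap.id ℝ _ := by
  rw [jacobian, coordExpr_id, fderiv_id]

/-- The homogeneous coordinates of `u (affineVec b y)` depend differentiably on `y`. -/
lemma differentiable_repr_affineVec (b b' : Module.Basis (Fin (n + 1)) ℝ V) (u : V ≃ₗ[ℝ] V)
    (j : Fin (n + 1)) : Differentiable ℝ fun y => b'.repr (u (affineVec b y)) j := by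
  have : (fun y => b'.repr (u (affineVec b y)) j) =
      fun y : Fin n → ℝ =>
        b'.repr (u (b 0)) j + ∑ i : Fin n, y i * b'.repr (u (b i.succ)) j := by
    funext y
    simp [affineVec]
  rw [this]
  fun_prop

/-- A projective transformation that fixes `A` has a coordinate expression that is
differentiable at `A`, and near `A` it stays in the domain of the target chart. -/
lemma coordExpr_facts {A : ℙ ℝ V} (g : centreStabilizer A) (b b' : AdaptedBasis n A) :
    DifferentiableAt ℝ (coordExpr (fun M => g.1.1 M) b.1 b'.1) 0 ∧
      coordExpr (fun M => g.1.1 M) b.1 b'.1 0 = 0 ∧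
      ∀ᶠ y in 𝓝 (0 : Fin n → ℝ),
        affineChartInv b'.1 (affineChart b'.1 (g.1.1 (affineChartInv b.1 y))) =
          g.1.1 (affineChartInv b.1 y) := by
  obtain ⟨⟨g, u, rfl⟩, hg⟩ := g
  have hgA : (MulAction.toPermHom (V ≃ₗ[ℝ] V) (ℙ ℝ V)) u A = A := hg
  have hne : ∀ y, u (affineVec b.1 y) ≠ 0 := fun y =>
    (u.map_ne_zero_iff).2 (affineVec_ne_zero b.1 y)
  have hmk : ∀ y, (MulAction.toPermHom (V ≃ₗ[ℝ] V) (ℙ ℝ V)) u (affineChartInv b.1 y) =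
      Projectivization.mk ℝ (u (affineVec b.1 y)) (hne y) := fun y => rfl
  have h0 : b'.1.repr (u (affineVec b.1 0)) 0 ≠ 0 := by
    have h1 := hmk 0
    rw [affineChartInv_zero b, hgA] at h1
    have h2 := b'.2.trans h1
    rw [Projectivization.mk_eq_mk_iff'] at h2
    obtain ⟨a, ha⟩ := h2
    intro h
    have h3 := congrArg (fun w => b'.1.repr w 0) ha
    simp [h] at h3
  refine ⟨?_, ?_, ?_⟩
  · have : coordExpr (fun M => (MulAction.toPermHom (V ≃ₗ[ℝ] V) (ℙ ℝ V)) u M) b.1 b'.1 =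
        fun y => fun i : Fin n =>
          b'.1.repr (u (affineVec b.1 y)) i.succ / b'.1.repr (u (affineVec b.1 y)) 0 := by
      funext y
      rw [coordExpr, hmk, affineChart_mk]
    change DifferentiableAt ℝ
      (coordExpr (fun M => (MulAction.toPermHom (V ≃ₗ[ℝ] V) (ℙ ℝ V)) u M) b.1 b'.1) 0
    rw [this, differentiableAt_pi]
    intro i
    have hi := (differentiable_repr_affineVec b.1 b'.1 u i.succ).differentiableAt (x := 0)
    have hj := (differentiable_repr_affineVec b.1 b'.1 u 0).differentiableAt (x := 0)
    simp only [div_eq_mul_inv]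
    exact hi.mul (hj.inv h0)
  · change affineChart b'.1 ((MulAction.toPermHom (V ≃ₗ[ℝ] V) (ℙ ℝ V)) u _) = 0
    rw [affineChartInv_zero, hgA, affineChart_centre]
  · have hc := (differentiable_repr_affineVec b.1 b'.1 u 0).continuous.continuousAt (x := 0)
    filter_upwards [hc.eventually_ne h0] with y hy
    change affineChartInv b'.1 (affineChart b'.1
      ((MulAction.toPermHom (V ≃ₗ[ℝ] V) (ℙ ℝ V)) u _)) =
        (MulAction.toPermHom (V ≃ₗ[ℝ] V) (ℙ ℝ V)) u _
    rw [hmk]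
    exact affineChartInv_affineChart_mk b'.1 _ _ hy

/-- The chain rule at `A`. -/
lemma jacobian_mul {A : ℙ ℝ V} (g' g : centreStabilizer A) (b b' b'' : AdaptedBasis n A)
    (v : Fin n → ℝ) :
    jacobian A (fun M => (g' * g).1.1 M) b b'' v =
      jacobian A (fun M => g'.1.1 M) b' b'' (jacobian A (fun M => g.1.1 M) b b' v) := by
  obtain ⟨hd, hz, he⟩ := coordExpr_facts g b b'
  obtain ⟨hd', -, -⟩ := coordExpr_facts g' b' b''
  have h : coordExpr (fun M => (g' * g).1.1 M) b.1 b''.1 =ᶠ[𝓝 0]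
      coordExpr (fun M => g'.1.1 M) b'.1 b''.1 ∘ coordExpr (fun M => g.1.1 M) b.1 b'.1 := by
    filter_upwards [he] with y hy
    simp only [coordExpr, Function.comp_apply]
    rw [hy]
    rfl
  rw [← hz] at hd'
  simp only [jacobian, affineChart_centre]
  rw [h.fderiv_eq, fderiv_comp _ hd' hd, hz]
  rfl

/-! ### The tangent space at the centre and the linearizing homomorphism -/

/-- The tangent space of the projective space at `A`: a tangent vector is a family of coordinate
vectors, one for each affine chart of an adapted frame, that transform by the Jacobian matrices
of the transition maps. -/
def centreTangentSpace (n : ℕ) (A : ℙ ℝ V) : Submodule ℝ (AdaptedBasis n A → (Fin n → ℝ)) where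
  carrier := {v | ∀ b b', v b' = jacobian A id b b' (v b)}
  add_mem' := by
    intro v w hv hw b b'
    rw [Pi.add_apply, Pi.add_apply, map_add, ← hv b b', ← hw b b']
  zero_mem' := by
    intro b b'
    simp
  smul_mem' := by
    intro c v hv b b'
    rw [Pi.smul_apply, Pi.smul_apply, map_smul, ← hv b b']

/-- The differential `d_A g` of a projective transformation `g` with `g A = A`, as an endomorphism
of the tangent space at `A`: in every chart it is given by the Jacobian matrix of `g`. -/
def centreDifferential (n : ℕ) (A : ℙ ℝ V) (g : centreStabilizer A) :
    Module.End ℝ (centreTangentSpace n A) where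
  toFun v := ⟨fun b => jacobian A (fun M => g.1.1 M) b b (v.1 b), by
    intro b b'
    have h1 := jacobian_mul 1 g b b b' (v.1 b)
    have h2 := jacobian_mul g 1 b b' b' (v.1 b)
    rw [one_mul] at h1
    rw [mul_one, h1] at h2
    change jacobian A (fun M => g.1.1 M) b' b' (v.1 b') = _
    rw [v.2 b b']
    exact h2.symm⟩
  map_add' v w := Subtype.ext (funext fun b => by simp)
  map_smul' c v := Subtype.ext (funext fun b => by simp)

/-- The linearizing homomorphism `β : G → GL(T_A)`, `g ↦ d_A g`. -/
def linearizing (n : ℕ) (A : ℙ ℝ V) :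
    centreStabilizer A →* LinearMap.GeneralLinearGroup ℝ (centreTangentSpace n A) :=
  MonoidHom.toHomUnits
    { toFun := centreDifferential n A
      map_one' := LinearMap.ext fun v => Subtype.ext (funext fun b => by
        change jacobian A id b b (v.1 b) = v.1 b
        rw [jacobian_id]; rfl)
      map_mul' := fun g' g => LinearMap.ext fun v => Subtype.ext (funext fun b =>
        jacobian_mul g' g b b b (v.1 b)) }

/-- The kernel `H` of the linearizing homomorphism. -/
abbrev linearizingKernel (n : ℕ) (A : ℙ ℝ V) : Subgroup (centreStabilizer A) :=
  (linearizing n A).ker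

/-- Two frames are equivalent if they belong to the same `H`-orbit, where `H` acts on frames
pointwise. -/
def ProjectiveFrame.Equivalent (A : ℙ ℝ V) (R R' : ProjectiveFrame V n) : Prop :=
  R'.points ∈ MulAction.orbit (linearizingKernel n A) R.points

end Charts

end

/-! Scale a basis so that `Aᵢ = [bᵢ]` and `E = [s]` with `s = ∑ bᵢ`. Perspective from `A = [b₀]`
then gives `A'ᵢ = [bᵢ + cᵢ b₀]` and `E' = [s + d b₀]`, with `d ≠ 0` by strictness. Both sides of the
equivalence say `∑ cᵢ = d`.

Up to scale, an element of `H` carrying each `Aᵢ` to `A'ᵢ` is the transvection fixing `b₀` and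
sending `bᵢ` to `bᵢ + cᵢ b₀`. It maps `s` to `s + (∑ cᵢ) b₀`, so it carries `E` to `E'` exactly when
`∑ cᵢ = d` (`equivalent_iff_sum_eq`).

The Desargues points lie in the kernel of the form `ψ` with `ψ bᵢ = cᵢ` for `i ≥ 1` and `ψ s = d`,
hence `ψ b₀ = d - ∑ cᵢ`. If `A` is in their span, this value is zero. Conversely, `Bᵢ = [d bᵢ - cᵢ
s]`, and when `∑ cᵢ = d` these representatives add up to `-d b₀`
(`mem_desarguesHyperplane_iff_sum_eq`). -/

/-! ### Lines in homogeneous coordinates. -/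

section Lines

variable {V : Type*} [AddCommGroup V] [Module ℝ V]

/-- Homogeneous coordinates on the line through two points. -/
lemma mk_mem_projLine_iff {p q w : V} (hp : p ≠ 0) (hq : q ≠ 0) (hw : w ≠ 0) :
    Projectivization.mk ℝ w hw ∈
        projLine (Projectivization.mk ℝ p hp) (Projectivization.mk ℝ q hq) ↔
      ∃ x y : ℝ, w = x • p + y • q := by
  constructor
  · intro h
    have h1 := (Projectivization.Subspace.mem_span _).1 h
      (Submodule.span ℝ {p, q}).projectivization (by
        rintro z (rfl | rfl)
        · exact Submodule.subset_span (by simp)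
        · exact Submodule.subset_span (by simp))
    rw [Submodule.mk_mem_projectivization_iff, Submodule.mem_span_pair] at h1
    obtain ⟨x, y, h1⟩ := h1
    exact ⟨x, y, h1.symm⟩
  · rintro ⟨x, y, rfl⟩
    rw [← Projectivization.Subspace.mem_submodule_iff _ hw]
    refine Submodule.add_mem _ (Submodule.smul_mem _ _ ?_) (Submodule.smul_mem _ _ ?_)
    · rw [Projectivization.Subspace.mem_submodule_iff _ hp]
      exact Projectivization.Subspace.subset_span _ (by simp)
    · rw [Projectivization.Subspace.mem_submodule_iff _ hq]
      exact Projectivization.Subspace.subset_span _ (by simp)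

/-- A point of a line other than the two given ones has a representative `p + c • q`. -/
lemma exists_eq_mk_add_smul {p q : V} (hp : p ≠ 0) (hq : q ≠ 0) {X : ℙ ℝ V}
    (hX : X ∈ projLine (Projectivization.mk ℝ p hp) (Projectivization.mk ℝ q hq))
    (hXp : X ≠ Projectivization.mk ℝ p hp) (hXq : X ≠ Projectivization.mk ℝ q hq) :
    ∃ c : ℝ, c ≠ 0 ∧ ∃ h : p + c • q ≠ 0, X = Projectivization.mk ℝ (p + c • q) h := by
  induction X using Projectivization.ind with | h w hw => ?_
  obtain ⟨x, y, rfl⟩ := (mk_mem_projLine_iff hp hq hw).1 hX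
  have hx : x ≠ 0 := by
    rintro rfl
    exact hXq ((Projectivization.mk_eq_mk_iff' ..).2 ⟨y, by simp⟩)
  have hy : y ≠ 0 := by
    rintro rfl
    exact hXp ((Projectivization.mk_eq_mk_iff' ..).2 ⟨x, by simp⟩)
  have key : x • (p + (x⁻¹ * y) • q) = x • p + y • q := by
    rw [smul_add, smul_smul, mul_inv_cancel_left₀ hx]
  refine ⟨x⁻¹ * y, mul_ne_zero (inv_ne_zero hx) hy, ?_, ?_⟩
  · intro h
    rw [h, smul_zero] at key
    exact hw key.symm
  · exact (Projectivization.mk_eq_mk_iff' ..).2 ⟨x, key⟩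

/-- A linear form with the values `c`, `d` at `p`, `q` vanishes on the common point of the lines
through `p`, `q` and through `p + c • a`, `q + d • a`. -/
lemma eq_zero_of_mem_projLines {p q a w : V} {c d : ℝ} {hp : p ≠ 0} {hq : q ≠ 0}
    {hp' : p + c • a ≠ 0} {hq' : q + d • a ≠ 0} {hw : w ≠ 0}
    (hli : ∀ x y z : ℝ, x • p + y • q + z • a = 0 → x = 0 ∧ y = 0 ∧ z = 0)
    (h : Projectivization.mk ℝ w hw ∈
      projLine (Projectivization.mk ℝ p hp) (Projectivization.mk ℝ q hq))
    (h' : Projectivization.mk ℝ w hw ∈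
      projLine (Projectivization.mk ℝ _ hp') (Projectivization.mk ℝ _ hq'))
    (ψ : V →ₗ[ℝ] ℝ) (hψp : ψ p = c) (hψq : ψ q = d) : ψ w = 0 := by
  obtain ⟨x, y, rfl⟩ := (mk_mem_projLine_iff hp hq hw).1 h
  obtain ⟨x', y', h2⟩ := (mk_mem_projLine_iff hp' hq' hw).1 h'
  -- Equating the two expansions of `w` leaves the coefficient `x' * c + y' * d` at `a`; this
  -- coefficient is also the value of `ψ` at `w`.
  obtain ⟨h3, h4, h5⟩ := hli (x' - x) (y' - y) (x' * c + y' * d) (by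
    rw [← sub_eq_zero.2 h2.symm]
    module)
  simp only [map_add, map_smul, hψp, hψq, smul_eq_mul]
  rw [← sub_eq_zero.1 h3, ← sub_eq_zero.1 h4, h5]

/-- The common point of two corresponding lines of a perspectivity. -/
lemma mk_smul_sub_smul_mem {p q a : V} {c d : ℝ} {hp : p ≠ 0} {hq : q ≠ 0}
    {hp' : p + c • a ≠ 0} {hq' : q + d • a ≠ 0} (hw : d • p - c • q ≠ 0) :
    Projectivization.mk ℝ (d • p - c • q) hw ∈
        projLine (Projectivization.mk ℝ p hp) (Projectivization.mk ℝ q hq) ∧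
      Projectivization.mk ℝ (d • p - c • q) hw ∈
        projLine (Projectivization.mk ℝ _ hp') (Projectivization.mk ℝ _ hq') :=
  ⟨(mk_mem_projLine_iff ..).2 ⟨d, -c, by module⟩, (mk_mem_projLine_iff ..).2 ⟨d, -c, by module⟩⟩

end Lines

/-! ### Frames and the bases that generate them. -/

namespace ProjectiveFrame

variable {V : Type*} [AddCommGroup V] [Module ℝ V] {n : ℕ}

lemma points_injective (hn : 1 ≤ n) (R : ProjectiveFrame V n) :
    Function.Injective R.points := by
  intro i j hij
  by_contra hne
  -- Omitting a third index, available since `n + 2 ≥ 3`, puts both points in one independent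
  -- family.
  obtain ⟨k, hk⟩ : ∃ k, k ∉ ({i, j} : Finset (Fin (n + 2))) := by
    by_contra! h
    have h1 := Finset.card_le_card (fun k _ => h k : (Finset.univ : Finset (Fin (n + 2))) ⊆ _)
    have h2 := Finset.card_le_two (a := i) (b := j)
    rw [Finset.card_univ, Fintype.card_fin] at h1
    omega
  simp only [Finset.mem_insert, Finset.mem_singleton, not_or] at hk
  obtain ⟨i', rfl⟩ := Fin.exists_succAbove_eq (Ne.symm hk.1)
  obtain ⟨j', rfl⟩ := Fin.exists_succAbove_eq (Ne.symm hk.2)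
  have h := (Projectivization.independent_iff.1 (R.generic k)).injective
  exact hne (congrArg _ (h (congrArg Projectivization.rep hij)))

lemma vertex_succ_ne_vertex_zero (hn : 1 ≤ n) (R : ProjectiveFrame V n) (i : Fin n) :
    R.vertex i.succ ≠ R.vertex 0 := fun h =>
  Fin.succ_ne_zero i (Fin.castSucc_injective _ (R.points_injective hn h))

lemma unit_ne_vertex_zero (hn : 1 ≤ n) (R : ProjectiveFrame V n) :
    R.unit ≠ R.vertex 0 := fun h =>
  (Fin.castSucc_lt_last 0).ne' (R.points_injective hn h)

/-- Every projective frame is generated by a basis. -/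
lemma exists_basis (hV : Module.finrank ℝ V = n + 1) (R : ProjectiveFrame V n) :
    ∃ b : Module.Basis (Fin (n + 1)) ℝ V,
      (∀ i, R.vertex i = Projectivization.mk ℝ (b i) (b.ne_zero i)) ∧
        ∃ h : ∑ i, b i ≠ 0, R.unit = Projectivization.mk ℝ (∑ i, b i) h := by
  have hli := Projectivization.independent_iff.1 (R.generic (Fin.last _))
  simp only [Fin.succAbove_last] at hli
  have hcard : Fintype.card (Fin (n + 1)) = Module.finrank ℝ V := by simp [hV]
  let e := basisOfLinearIndependentOfCardEqFinrank hli hcard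
  have hei : ∀ i, e i = (R.points i.castSucc).rep := fun i => by simp [e]
  set x := e.repr R.unit.rep with hxdef
  have hx : ∀ i, x i ≠ 0 := by
    intro k hk
    have hli' := Fintype.linearIndependent_iff.1
      (Projectivization.independent_iff.1 (R.generic k.castSucc))
    -- The relation `∑ xᵢ Aᵢ - E = 0` between representatives: if `x k = 0`, it is a relation among
    -- the points other than the `k`-th, with coefficient `-1` at `E`.
    let y : Fin (n + 2) → ℝ := Fin.snoc (fun i => x i) (-1)
    have hsum : ∑ i, y i • (R.points i).rep = 0 := by
      rw [Fin.sum_univ_castSucc]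
      simp only [y, Fin.snoc_castSucc, Fin.snoc_last, ← hei]
      rw [hxdef, e.sum_repr]
      simp [unit]
    rw [Fin.sum_univ_succAbove _ k.castSucc] at hsum
    rw [show y k.castSucc = 0 by simp [y, hk], zero_smul, zero_add] at hsum
    obtain ⟨j, hj⟩ := Fin.exists_succAbove_eq (Fin.castSucc_lt_last k).ne'
    have h1 : y (k.castSucc.succAbove j) = 0 :=
      hli' (fun i => y (k.castSucc.succAbove i)) hsum j
    simp [hj, y] at h1
  refine ⟨e.isUnitSMul (w := x) fun i => (hx i).isUnit, fun i => ?_, ?_⟩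
  · rw [vertex, ← Projectivization.mk_rep (R.points i.castSucc), Projectivization.mk_eq_mk_iff']
    refine ⟨(x i)⁻¹, ?_⟩
    rw [Module.Basis.isUnitSMul_apply, inv_smul_smul₀ (hx i), hei]
  · have hs : ∑ i, e.isUnitSMul (w := x) (fun i => (hx i).isUnit) i = R.unit.rep := by
      simp only [Module.Basis.isUnitSMul_apply]
      exact e.sum_repr _
    simp only [hs]
    exact ⟨R.unit.rep_nonzero, (Projectivization.mk_rep _).symm⟩

end ProjectiveFrame

/-! ### Jacobians at the centre and the kernel `H`. -/

section Jacobian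

variable {V : Type*} [AddCommGroup V] [Module ℝ V] {n : ℕ} {A : ℙ ℝ V}

/-- The Jacobian matrix at `A` of the projective transformation induced by `u`. -/
lemma jacobian_apply (g : centreStabilizer A) (u : V ≃ₗ[ℝ] V)
    (hgu : MulAction.toPermHom (V ≃ₗ[ℝ] V) (ℙ ℝ V) u = g.1.1) (b b' : AdaptedBasis n A)
    {r : ℝ} (hr : r ≠ 0) (hu : u (b.1 0) = r • b'.1 0) (w : Fin n → ℝ) (i : Fin n) :
    jacobian A (fun M => g.1.1 M) b b' w i =
      b'.1.repr (u (∑ j, w j • b.1 j.succ)) i.succ / r := by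
  obtain ⟨hd, -, -⟩ := coordExpr_facts g b b'
  -- Along `t ↦ t • w` the coordinate expression is an explicit rational function of `t`, so the
  -- Jacobian is read off from a one-variable derivative.
  have h1 : HasDerivAt (fun t : ℝ => t • w) w 0 := by
    simpa using (hasDerivAt_id (0 : ℝ)).smul_const w
  have h2 : HasDerivAt (fun t : ℝ => coordExpr (fun M => g.1.1 M) b.1 b'.1 (t • w))
      (fderiv ℝ (coordExpr (fun M => g.1.1 M) b.1 b'.1) 0 w) 0 :=
    HasFDerivAt.comp_hasDerivAt (x := (0 : ℝ)) (f := fun t : ℝ => t • w)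
      (l := coordExpr (fun M => g.1.1 M) b.1 b'.1)
      (by simpa using hd.hasFDerivAt) h1
  have h3 := hasDerivAt_pi.1 h2 i
  set v := u (∑ j, w j • b.1 j.succ) with hv
  have hvec : ∀ t : ℝ, u (affineVec b.1 (t • w)) = r • b'.1 0 + t • v := fun t => by
    simp only [affineVec, map_add, hu, hv, Pi.smul_apply, smul_assoc, ← Finset.smul_sum, map_smul]
  have h4 : (fun t : ℝ => coordExpr (fun M => g.1.1 M) b.1 b'.1 (t • w) i) =
      fun t : ℝ => t * b'.1.repr v i.succ / (r + t * b'.1.repr v 0) := by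
    funext t
    have hmk : g.1.1 (affineChartInv b.1 (t • w)) =
        Projectivization.mk ℝ (u (affineVec b.1 (t • w)))
          (u.map_ne_zero_iff.2 (affineVec_ne_zero b.1 _)) := by
      rw [← hgu]; rfl
    rw [coordExpr, hmk, affineChart_mk, hvec]
    simp
  have h5 : HasDerivAt (fun t : ℝ => t * b'.1.repr v i.succ / (r + t * b'.1.repr v 0))
      (b'.1.repr v i.succ / r) 0 := by
    have := ((hasDerivAt_id (0 : ℝ)).mul_const (b'.1.repr v i.succ)).div
      (((hasDerivAt_id (0 : ℝ)).mul_const (b'.1.repr v 0)).const_add r) (by simpa using hr)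
    convert! this using 1
    simp
    field_simp
  rw [h4] at h3
  rw [jacobian, affineChart_centre]
  exact h3.unique h5

lemma mem_linearizingKernel_iff (g : centreStabilizer A) :
    g ∈ linearizingKernel n A ↔
      ∀ b : AdaptedBasis n A, ∀ w, jacobian A (fun M => g.1.1 M) b b w = w := by
  have hmem : g ∈ linearizingKernel n A ↔ centreDifferential n A g = 1 := by
    rw [MonoidHom.mem_ker, Units.ext_iff]
    rfl
  rw [hmem]
  constructor
  · intro h b w
    -- Transition Jacobians extend any coordinate vector in one chart to a tangent vector;
    -- compatibility is the chain rule for the identity.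
    let v : centreTangentSpace n A := ⟨fun b' => jacobian A id b b' w, fun b' b'' =>
      jacobian_mul (1 : centreStabilizer A) 1 b b' b'' w⟩
    have hv : v.1 b = w := by
      change jacobian A id b b w = w
      rw [jacobian_id]
      rfl
    have h1 := congrFun (congrArg Subtype.val (LinearMap.congr_fun h v)) b
    change jacobian A (fun M => g.1.1 M) b b (v.1 b) = v.1 b at h1
    rwa [hv] at h1
  · intro h
    exact LinearMap.ext fun v => Subtype.ext (funext fun b => h b _)

end Jacobian

/-! ### The two criteria `∑ cᵢ = d`. -/

namespace ProjectiveFrame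

variable {V : Type*} [AddCommGroup V] [Module ℝ V] {n : ℕ}

/-- A frame with the vertices `bᵢ` and the unit point `∑ bᵢ` is carried by the kernel `H` to the
frame with the vertices `b₀`, `bᵢ + cᵢ b₀` and the unit point `∑ bᵢ + d b₀` if and only if
`∑ cᵢ = d`. -/
lemma equivalent_iff_sum_eq (hn : 1 ≤ n) {R R' : ProjectiveFrame V n}
    (b : Module.Basis (Fin (n + 1)) ℝ V)
    (hb : ∀ i, R.vertex i = Projectivization.mk ℝ (b i) (b.ne_zero i))
    (hs : ∑ i, b i ≠ 0) (hE : R.unit = Projectivization.mk ℝ (∑ i, b i) hs)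
    (hb0 : R'.vertex 0 = Projectivization.mk ℝ (b 0) (b.ne_zero 0))
    {c : Fin n → ℝ} (hc : ∀ i : Fin n, b i.succ + c i • b 0 ≠ 0)
    (hb' : ∀ i : Fin n, R'.vertex i.succ = Projectivization.mk ℝ _ (hc i))
    {d : ℝ} (hd : ∑ i, b i + d • b 0 ≠ 0) (hE' : R'.unit = Projectivization.mk ℝ _ hd) :
    R.Equivalent (Projectivization.mk ℝ (b 0) (b.ne_zero 0)) R' ↔ ∑ i, c i = d := by
  constructor
  · rintro ⟨⟨⟨⟨g, u, rfl⟩, hA⟩, hk⟩, hg⟩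
    have hu0 : Projectivization.mk ℝ (u (b 0)) (u.map_ne_zero_iff.2 (b.ne_zero 0)) =
      Projectivization.mk ℝ (b 0) (b.ne_zero 0) := hA
    obtain ⟨r, hr⟩ := (Projectivization.mk_eq_mk_iff' ..).1 hu0
    have hr0 : r ≠ 0 := by
      rintro rfl
      rw [zero_smul] at hr
      exact u.map_ne_zero_iff.2 (b.ne_zero 0) hr.symm
    have hvert : ∀ k, (MulAction.toPermHom (V ≃ₗ[ℝ] V) (ℙ ℝ V)) u (R.points k) = R'.points k :=
      fun k => congrFun hg k
    have hcoord := (mem_linearizingKernel_iff _).1 hk ⟨b, rfl⟩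
    have hu : ∀ j : Fin n, u (b j.succ) = r • (b j.succ + c j • b 0) := by
      intro j
      have h1 : Projectivization.mk ℝ (u (b j.succ)) (u.map_ne_zero_iff.2 (b.ne_zero _)) =
          Projectivization.mk ℝ _ (hc j) := by
        have h2 := hvert j.succ.castSucc
        change (MulAction.toPermHom (V ≃ₗ[ℝ] V) (ℙ ℝ V)) u (R.vertex j.succ) = R'.vertex j.succ at h2
        rw [hb, hb'] at h2
        exact h2
      obtain ⟨s, hs⟩ := (Projectivization.mk_eq_mk_iff' ..).1 h1
      -- The `j`-th diagonal entry of the Jacobian is `s / r`, so `s = r`.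
      have h3 := congrFun (hcoord (Pi.single j 1)) j
      rw [jacobian_apply _ u rfl _ _ hr0 hr.symm] at h3
      have h4 : ∑ i, (Pi.single j (1 : ℝ) : Fin n → ℝ) i • b i.succ = b j.succ := by
        rw [Finset.sum_eq_single j] <;> simp +contextual
      simp only [h4, ← hs] at h3
      simp [div_eq_iff hr0] at h3
      rw [← hs, h3]
    have h1 : Projectivization.mk ℝ (u (∑ i, b i)) (u.map_ne_zero_iff.2 hs) =
        Projectivization.mk ℝ _ hd := by
      have h2 := hvert (Fin.last _)
      change (MulAction.toPermHom (V ≃ₗ[ℝ] V) (ℙ ℝ V)) u R.unit = R'.unit at h2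
      rw [hE, hE'] at h2
      exact h2
    obtain ⟨s, hs⟩ := (Projectivization.mk_eq_mk_iff' ..).1 h1
    have hsum : u (∑ i, b i) = r • (∑ i, b i + (∑ i, c i) • b 0) := by
      simp only [Fin.sum_univ_succ, map_add, map_sum, ← hr, hu, Finset.smul_sum, smul_add,
        Finset.sum_add_distrib, Finset.sum_smul]
      abel
    rw [hsum] at hs
    have hone : ∀ i, b.repr (∑ i, b i) i = 1 := fun i => by
      simp [Finsupp.single_apply]
    -- Coordinate 1 gives `s = r`; coordinate 0 then compares `d` with `∑ cᵢ`.
    have e0 := congrArg (fun v => b.repr v 0) hs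
    have e1 := congrArg (fun v => b.repr v (Fin.succ ⟨0, hn⟩)) hs
    simp only [map_add, map_smul, Finsupp.add_apply, Finsupp.smul_apply, hone,
      Module.Basis.repr_self, Finsupp.single_apply, smul_eq_mul, if_true,
      (Fin.succ_ne_zero _).symm, if_false, mul_one, mul_zero, add_zero] at e0 e1
    subst e1
    have := mul_left_cancel₀ hr0 e0
    linarith
  · rintro rfl
    let φ : V →ₗ[ℝ] ℝ := b.constr ℝ (Fin.cons 0 c)
    have hφ0 : φ (b 0) = 0 := by simp [φ]
    have hφ : ∀ i : Fin n, φ (b i.succ) = c i := fun i => by simp [φ]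
    let u : V ≃ₗ[ℝ] V := LinearEquiv.transvection hφ0
    have hu : ∀ v, u v = v + φ v • b 0 := fun v => rfl
    have hmk : ∀ v (hv : v ≠ 0), (MulAction.toPermHom (V ≃ₗ[ℝ] V) (ℙ ℝ V)) u
        (Projectivization.mk ℝ v hv) = Projectivization.mk ℝ (u v) (u.map_ne_zero_iff.2 hv) :=
      fun v hv => rfl
    let g : centreStabilizer (Projectivization.mk ℝ (b 0) (b.ne_zero 0)) :=
      ⟨⟨_, u, rfl⟩, by
        change (MulAction.toPermHom (V ≃ₗ[ℝ] V) (ℙ ℝ V)) u _ = _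
        rw [hmk]
        simp [hu, hφ0]⟩
    refine ⟨⟨g, ?_⟩, ?_⟩
    · rw [mem_linearizingKernel_iff]
      intro b' w
      obtain ⟨r, hr⟩ := (Projectivization.mk_eq_mk_iff' ..).1 b'.2
      have hr0 : r ≠ 0 := by
        rintro rfl
        exact b'.1.ne_zero 0 (by simpa using hr.symm)
      funext i
      -- In every adapted basis `b₀` is a multiple of the first vector, so the added term `φ v • b
      -- 0` is invisible to first order at `A`.
      have hb0' : b'.1.repr (b 0) i.succ = 0 := by
        have h1 := congrArg (fun v => b'.1.repr v i.succ) hr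
        simpa [hr0] using h1
      rw [jacobian_apply g u rfl b' b' one_ne_zero (by rw [← hr]; simp [hu, hφ0]), hu]
      simp [Finsupp.single_apply, hb0']
    · funext k
      change (MulAction.toPermHom (V ≃ₗ[ℝ] V) (ℙ ℝ V)) u (R.points k) = R'.points k
      refine Fin.lastCases ?_ (fun k => Fin.cases ?_ (fun i => ?_) k) k
      · change (MulAction.toPermHom (V ≃ₗ[ℝ] V) (ℙ ℝ V)) u R.unit = R'.unit
        rw [hE, hE', hmk]
        congr 1
        rw [hu, map_sum, Fin.sum_univ_succ (fun i => φ (b i)), hφ0, zero_add]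
        simp only [hφ]
      · change (MulAction.toPermHom (V ≃ₗ[ℝ] V) (ℙ ℝ V)) u (R.vertex 0) = R'.vertex 0
        rw [hb, hb0, hmk]
        simp [hu, hφ0]
      · change (MulAction.toPermHom (V ≃ₗ[ℝ] V) (ℙ ℝ V)) u (R.vertex i.succ) = R'.vertex i.succ
        rw [hb, hb', hmk]
        simp [hu, hφ]

/-- The centre lies on the Desargues hyperplane if and only if `∑ cᵢ = d`. -/
lemma mem_desarguesHyperplane_iff_sum_eq (hn : 2 ≤ n) {R R' : ProjectiveFrame V n}
    (b : Module.Basis (Fin (n + 1)) ℝ V)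
    (hb : ∀ i, R.vertex i = Projectivization.mk ℝ (b i) (b.ne_zero i))
    (hs : ∑ i, b i ≠ 0) (hE : R.unit = Projectivization.mk ℝ (∑ i, b i) hs)
    {c : Fin n → ℝ} (hc : ∀ i : Fin n, b i.succ + c i • b 0 ≠ 0)
    (hb' : ∀ i : Fin n, R'.vertex i.succ = Projectivization.mk ℝ _ (hc i))
    {d : ℝ} (hd0 : d ≠ 0) (hd : ∑ i, b i + d • b 0 ≠ 0)
    (hE' : R'.unit = Projectivization.mk ℝ _ hd) :
    Projectivization.mk ℝ (b 0) (b.ne_zero 0) ∈ R.desarguesHyperplane R' ↔ ∑ i, c i = d := by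
  have hone : ∀ i, b.repr (∑ i, b i) i = 1 := fun i => by
    simp [Finsupp.single_apply]
  constructor
  · intro h
    let ψ : V →ₗ[ℝ] ℝ := b.constr ℝ (Fin.cons (d - ∑ i, c i) c)
    have hψ0 : ψ (b 0) = d - ∑ i, c i := by simp [ψ]
    have hψ : ∀ i : Fin n, ψ (b i.succ) = c i := fun i => by simp [ψ]
    have hψs : ψ (∑ i, b i) = d := by
      rw [map_sum, Fin.sum_univ_succ, hψ0]
      simp only [hψ, sub_add_cancel]
    have h1 := (Projectivization.Subspace.mem_span _).1 h (LinearMap.ker ψ).projectivization (by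
      intro B hB
      induction B using Projectivization.ind with | h w hw => ?_
      rw [SetLike.mem_coe, Submodule.mk_mem_projectivization_iff, LinearMap.mem_ker]
      rcases hB with ⟨i, j, hij, hB, hB'⟩ | ⟨i, hB, hB'⟩
      · rw [hb, hb] at hB
        rw [hb', hb'] at hB'
        refine eq_zero_of_mem_projLines (fun x y z hxyz => ?_) hB hB' ψ (hψ i) (hψ j)
        have e := fun k => congrArg (fun v => b.repr v k) hxyz
        have ei := e i.succ
        have ej := e j.succ
        have ek := e 0
        simp [hij.ne, hij.ne'] at ei ej ek
        exact ⟨ei, ej, ek⟩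
      · rw [hb, hE] at hB
        rw [hb', hE'] at hB'
        refine eq_zero_of_mem_projLines (fun x y z hxyz => ?_) hB hB' ψ (hψ i) hψs
        have : Nontrivial (Fin n) := Fin.nontrivial_iff_two_le.2 hn
        -- A coordinate other than `0` and `i` isolates the coefficient of `∑ bₖ`; this is where `n
        -- ≥ 2` enters.
        obtain ⟨j, hj⟩ := exists_ne i
        have e := fun k => congrArg (fun v => b.repr v k) hxyz
        have ei := e i.succ
        have ej := e j.succ
        have ek := e 0
        simp only [map_add, map_smul, Finsupp.add_apply, Finsupp.smul_apply, hone,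
          Module.Basis.repr_self, Finsupp.single_apply, smul_eq_mul, if_true, Fin.succ_inj, hj.symm,
          Fin.succ_ne_zero, (Fin.succ_ne_zero _).symm, if_false, mul_one, mul_zero, add_zero,
          zero_add, map_zero, Finsupp.zero_apply] at ei ej ek
        subst ej
        simp at ei ek
        exact ⟨ei, rfl, ek⟩)
    rw [Submodule.mk_mem_projectivization_iff, LinearMap.mem_ker, hψ0] at h1
    linarith
  · intro h
    rw [← Projectivization.Subspace.mem_submodule_iff _ (b.ne_zero 0)]
    have hmem : ∀ i : Fin n, d • b i.succ - c i • ∑ k, b k ∈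
        -- Membership here unfolds to a condition on nonzero vectors only, so `intro` supplies `hw`.
        Projectivization.Subspace.submodule (R.desarguesHyperplane R') := by
      intro i hw
      refine Projectivization.Subspace.subset_span _ (Or.inr ⟨i, ?_⟩)
      rw [hb, hE, hb', hE']
      exact mk_smul_sub_smul_mem hw
    have hsum : ∑ i : Fin n, (d • b i.succ - c i • ∑ k, b k) = (-d) • b 0 := by
      rw [Finset.sum_sub_distrib, ← Finset.smul_sum, ← Finset.sum_smul, h, Fin.sum_univ_succ]
      module
    rw [← Submodule.smul_mem_iff _ (neg_ne_zero.2 hd0), ← hsum]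
    exact Submodule.sum_mem _ fun i _ => hmem i

end ProjectiveFrame

theorem theorem6p1 {n : ℕ} (hn : 2 ≤ n) {V : Type*} [AddCommGroup V] [Module ℝ V]
    (hV : Module.finrank ℝ V = n + 1) (A : Projectivization ℝ V)
    (R R' : ProjectiveFrame V n) (hR : R.IsAdapted A) (hR' : R'.IsAdapted A)
    (hRR' : R.InStrictPerspective R') :
    R.Equivalent A R' ↔ A ∈ R.desarguesHyperplane R' := by
  have hn1 : 1 ≤ n := by omega
  obtain ⟨b, hb, hs, hE⟩ := R.exists_basis hV
  obtain ⟨⟨hlines, hunit⟩, hne, hneE⟩ := hRR'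
  have h0 : R'.vertex 0 = R.vertex 0 := hR'.trans hR.symm
  obtain rfl : R.vertex 0 = A := hR
  have hverts := fun i : Fin n => exists_eq_mk_add_smul (b.ne_zero i.succ) (b.ne_zero 0)
    (by simpa only [hb] using hlines i) (by simpa only [hb] using hne i)
    (by simpa only [h0, hb] using R'.vertex_succ_ne_vertex_zero hn1 i)
  choose c _ hc hb' using hverts
  obtain ⟨d, hd0, hd, hE'⟩ := exists_eq_mk_add_smul hs (b.ne_zero 0)
    (by simpa only [hb, hE] using hunit) (by simpa only [hE] using hneE)
    (by simpa only [h0, hb] using R'.unit_ne_vertex_zero hn1)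
  rw [hb 0, ProjectiveFrame.equivalent_iff_sum_eq hn1 b hb hs hE (h0.trans (hb 0)) hc hb' hd hE',
    ProjectiveFrame.mem_desarguesHyperplane_iff_sum_eq hn b hb hs hE hc hb' hd0 hd hE']
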